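/- For a locally finite groupoid $\mathcal G$ (all hom-sets finite), its groupoid cardinality is $|\mathcal G|=\sum_{[x]}\frac{1}{\#\mathrm{Aut}(x)}\in[0,\infty]$, the sum running over the isomorphism classes of objects of $\mathcal G$. Let $\mathcal B$ be a groupoid. A functor $F:\mathcal G\to\mathcal B$ from a groupoid $\mathcal G$ is called relatively finite if for every object $y$ of $\mathcal B$ the full subgroupoid $F^{-1}(y)$ of $\mathcal G$ on the objects $x$ with $F(x)\cong y$ is equivalent to a finite groupoid (finitely many objects and morphisms). Let $\mathrm{RelFin}_{\mathcal B}$ be the following $(2,1)$-category. Its objects are the relatively finite functors $F:\mathcal G\to\mathcal B$. Its 1-morphisms from $F_1:\mathcal G_1\to\mathcal B$ to $F_2:\mathcal G_2\to\mathcal B$ are the pairs $(\Phi,\eta)$ of a functor $\Phi:\mathcal G_1\to\mathcal G_2$ and a natural isomorphism $\eta:F_1\Rightarrow F_2\Phi$. Its 2-morphisms $(\Phi_1,\eta_1)\Rightarrow(\Phi_2,\eta_2)$ are the natural isomorphisms $\psi:\Phi_1\Rightarrow\Phi_2$ with $\eta_2=F_2\psi\circ\eta_1$. Write $\mathrm{RelFin}_{\mathcal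 B}(F_1,F_2)$ for the groupoid of 1-morphisms $F_1\to F_2$ and 2-morphisms between them. For a finite group $H$ let $BH$ be the one-object groupoid with automorphism group $H$; every functor $BH\to\mathcal B$ is relatively finite. Theorem. Let $\mathcal B$ be a locally finite groupoid, and let $F:\mathcal G\to\mathcal B$ and $F':\mathcal G'\to\mathcal B$ be relatively finite functors such that for all finite groups $H$ and all functors $S:BH\to\mathcal B$ $$|\mathrm{RelFin}_{\mathcal B}(S,F)|=|\mathrm{RelFin}_{\mathcal B}(S,F')|.$$ Then $F$ and $F'$ are equivalent as objects of the $(2,1)$-category $\mathrm{RelFin}_{\mathcal B}$. -/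

import Mathlib

open CategoryTheory
open scoped ENNReal Bicategory

universe v u v₁ u₁

/-! ### Groupoid cardinality -/

/-- A groupoid is locally finite if all its hom-sets are finite. -/
def IsLocallyFiniteGroupoid (C : Type u) [Groupoid.{v} C] : Prop :=
  ∀ x y : C, Finite (x ⟶ y)

/-- The groupoid cardinality `∑ 1 / #Aut(x)`, summed over the isomorphism classes `[x]`,
as an element of `[0, ∞]`. (An infinite automorphism group would contribute `1 / ∞ = 0`; in a
locally finite groupoid there is none.) -/
noncomputable def groupoidCardinality (C : Type u) [Groupoid.{v} C] : ℝ≥0∞ :=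
  ∑' c : Quotient (isIsomorphicSetoid C),
    Quotient.lift (fun x : C => ((ENat.card (Aut x) : ENat) : ℝ≥0∞)⁻¹)
      (by
        rintro x y ⟨e⟩
        rw [ENat.card_congr (Aut.autMulEquivOfIso e).toEquiv]) c

/-! ### The slice (2,1)-category of groupoids over `B` -/

/-- An object of the slice over `B`: a groupoid with a functor to `B`. -/
structure GrpdOver (B : Type u) [Groupoid.{v} B] where
  /-- the total groupoid -/
  carrier : Type u₁
  /-- its groupoid structure -/
  [str : Groupoid.{v₁} carrier]
  /-- the functor to `B` -/
  functor : carrier ⥤ B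

attribute [instance] GrpdOver.str

namespace GrpdOver

variable {B : Type u} [Groupoid.{v} B]

/-- A 1-morphism `(Φ, η)` of the slice: a functor `Φ` between the total groupoids and a natural
isomorphism `η : F₁ ⇒ F₂ Φ`. -/
structure Hom (X Y : GrpdOver.{v, u, v₁, u₁} B) where
  /-- the functor `Φ` -/
  functor : X.carrier ⥤ Y.carrier
  /-- the natural isomorphism `η : F₁ ⇒ F₂ Φ` -/
  iso : X.functor ≅ functor ⋙ Y.functor

/-- A 2-morphism `(Φ₁, η₁) ⇒ (Φ₂, η₂)` of the slice: a natural transformation `ψ : Φ₁ ⇒ Φ₂`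
(automatically invertible, its target being a groupoid) with `η₂ = F₂ ψ ∘ η₁`. -/
@[ext]
structure Hom₂ {X Y : GrpdOver.{v, u, v₁, u₁} B} (f g : Hom X Y) where
  /-- the natural transformation `ψ` -/
  natTrans : f.functor ⟶ g.functor
  /-- the compatibility `η₂ = F₂ ψ ∘ η₁` -/
  w : f.iso.hom ≫ Functor.whiskerRight natTrans Y.functor = g.iso.hom

/-- The hom-groupoids of the slice. -/
instance homGroupoid (X Y : GrpdOver.{v, u, v₁, u₁} B) : Groupoid (Hom X Y) where
  Hom f g := Hom₂ f g
  id f := ⟨𝟙 f.functor, by simp⟩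
  comp a b := ⟨a.natTrans ≫ b.natTrans, by
    rw [Functor.whiskerRight_comp, ← Category.assoc, a.w, b.w]⟩
  id_comp a := Hom₂.ext (Category.id_comp _)
  comp_id a := Hom₂.ext (Category.comp_id _)
  assoc a b c := Hom₂.ext (Category.assoc _ _ _)
  inv {f g} a :=
    ⟨{ app := fun x => Groupoid.inv (a.natTrans.app x)
       naturality := fun x y k => by simp [Groupoid.inv_eq_inv] }, by
      rw [← a.w]
      ext x
      simp [Groupoid.inv_eq_inv]⟩
  inv_comp a := Hom₂.ext (by ext x; exact Groupoid.inv_comp _)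
  comp_inv a := Hom₂.ext (by ext x; exact Groupoid.comp_inv _)

instance categoryStruct : CategoryStruct (GrpdOver.{v, u, v₁, u₁} B) where
  Hom X Y := Hom X Y
  id X := ⟨𝟭 X.carrier, X.functor.leftUnitor.symm⟩
  comp {_ _ Z} f g := ⟨f.functor ⋙ g.functor,
    f.iso ≪≫ Functor.isoWhiskerLeft f.functor g.iso ≪≫
      (Functor.associator f.functor g.functor Z.functor).symm⟩

instance groupoidHom (X Y : GrpdOver.{v, u, v₁, u₁} B) : Groupoid (X ⟶ Y) :=
  inferInstanceAs (Groupoid (Hom X Y))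

theorem hom₂_ext {X Y : GrpdOver.{v, u, v₁, u₁} B} {f g : X ⟶ Y} {a b : f ⟶ g}
    (h : ∀ x, (Hom₂.natTrans a).app x = (Hom₂.natTrans b).app x) : a = b :=
  Hom₂.ext (NatTrans.ext (funext h))

/-- A natural transformation with the required compatibility, given componentwise. -/
def mkHom₂ {X Y : GrpdOver.{v, u, v₁, u₁} B} (f g : X ⟶ Y) (a : f.functor ⟶ g.functor)
    (w : ∀ x, f.iso.hom.app x ≫ Y.functor.map (a.app x) = g.iso.hom.app x) : f ⟶ g :=
  Hom₂.mk a (NatTrans.ext (funext w))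

/-- The isomorphism of 1-morphisms underlying a 2-morphism. -/
def isoOfHom₂ {X Y : GrpdOver.{v, u, v₁, u₁} B} {f g : X ⟶ Y} (a : f ⟶ g) : f ≅ g :=
  (Groupoid.isoEquivHom f g).symm a

@[simp]
theorem id_natTrans_app {X Y : GrpdOver.{v, u, v₁, u₁} B} (f : X ⟶ Y) (x : X.carrier) :
    (Hom₂.natTrans (𝟙 f)).app x = 𝟙 (f.functor.obj x) := rfl

@[simp]
theorem comp_natTrans_app {X Y : GrpdOver.{v, u, v₁, u₁} B} {f g h : X ⟶ Y}
    (a : f ⟶ g) (b : g ⟶ h) (x : X.carrier) :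
    (Hom₂.natTrans (a ≫ b)).app x = (Hom₂.natTrans a).app x ≫ (Hom₂.natTrans b).app x := rfl

@[simp]
theorem mkHom₂_natTrans {X Y : GrpdOver.{v, u, v₁, u₁} B} (f g : X ⟶ Y)
    (a : f.functor ⟶ g.functor) (w) : Hom₂.natTrans (mkHom₂ f g a w) = a := rfl

@[simp]
theorem isoOfHom₂_hom {X Y : GrpdOver.{v, u, v₁, u₁} B} {f g : X ⟶ Y} (a : f ⟶ g) :
    (isoOfHom₂ a).hom = a := rfl

@[simp]
theorem isoOfHom₂_inv_natTrans_app {X Y : GrpdOver.{v, u, v₁, u₁} B} {f g : X ⟶ Y} (a : f ⟶ g)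
    (x : X.carrier) :
    (Hom₂.natTrans (isoOfHom₂ a).inv).app x = inv ((Hom₂.natTrans a).app x) :=
  Groupoid.inv_eq_inv _

@[simp]
theorem id_functor (X : GrpdOver.{v, u, v₁, u₁} B) : Hom.functor (𝟙 X) = 𝟭 X.carrier := rfl

@[simp]
theorem comp_functor {X Y Z : GrpdOver.{v, u, v₁, u₁} B} (f : X ⟶ Y) (g : Y ⟶ Z) :
    Hom.functor (f ≫ g) = f.functor ⋙ g.functor := rfl

@[simp]
theorem id_iso_hom_app (X : GrpdOver.{v, u, v₁, u₁} B) (x : X.carrier) :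
    (Hom.iso (𝟙 X)).hom.app x = 𝟙 (X.functor.obj x) := rfl

@[simp]
theorem comp_iso_hom_app {X Y Z : GrpdOver.{v, u, v₁, u₁} B} (f : X ⟶ Y) (g : Y ⟶ Z)
    (x : X.carrier) :
    (Hom.iso (f ≫ g)).hom.app x = f.iso.hom.app x ≫ g.iso.hom.app (f.functor.obj x) := by
  change f.iso.hom.app x ≫ g.iso.hom.app (f.functor.obj x) ≫ 𝟙 _ = _
  rw [Category.comp_id]

theorem hom₂_w_app {X Y : GrpdOver.{v, u, v₁, u₁} B} {f g : X ⟶ Y} (a : f ⟶ g) (x : X.carrier) :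
    f.iso.hom.app x ≫ Y.functor.map ((Hom₂.natTrans a).app x) = g.iso.hom.app x :=
  NatTrans.congr_app (Hom₂.w a) x

/-- The slice (2,1)-category of groupoids over `B`. -/
instance bicategory : Bicategory (GrpdOver.{v, u, v₁, u₁} B) where
  homCategory X Y := (groupoidHom X Y).toCategory
  whiskerLeft {X Y Z} f g h a := mkHom₂ (f ≫ g) (f ≫ h)
    (Functor.whiskerLeft f.functor (Hom₂.natTrans a)) (fun x => by
      rw [comp_iso_hom_app, comp_iso_hom_app, ← hom₂_w_app a, Category.assoc]; rfl)
  whiskerRight {X Y Z} f g a h := mkHom₂ (f ≫ h) (g ≫ h)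
    (Functor.whiskerRight (Hom₂.natTrans a) h.functor) (fun x => by
      rw [comp_iso_hom_app, comp_iso_hom_app, ← hom₂_w_app a, Category.assoc, Category.assoc]
      exact congrArg _ (h.iso.hom.naturality ((Hom₂.natTrans a).app x)).symm)
  associator f g h := isoOfHom₂ (mkHom₂ ((f ≫ g) ≫ h) (f ≫ g ≫ h)
    (Functor.associator f.functor g.functor h.functor).hom (fun x => by simp))
  leftUnitor {X Y} f := isoOfHom₂ (mkHom₂ (𝟙 X ≫ f) f f.functor.leftUnitor.hom
    (fun x => by simp))
  rightUnitor {X Y} f := isoOfHom₂ (mkHom₂ (f ≫ 𝟙 Y) f f.functor.rightUnitor.hom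
    (fun x => by simp))
  whiskerLeft_id _ _ := hom₂_ext fun x => by simp
  whiskerLeft_comp _ _ _ _ _ _ := hom₂_ext fun x => by simp
  id_whiskerLeft _ := hom₂_ext fun x => by simp
  comp_whiskerLeft _ _ _ _ _ := hom₂_ext fun x => by simp
  id_whiskerRight _ _ := hom₂_ext fun x => by simp
  comp_whiskerRight _ _ _ := hom₂_ext fun x => by simp
  whiskerRight_id _ := hom₂_ext fun x => by simp
  whiskerRight_comp _ _ _ := hom₂_ext fun x => by simp
  whisker_assoc _ _ _ _ _ := hom₂_ext fun x => by simp
  whisker_exchange _ _ := hom₂_ext fun x => by simp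
  pentagon _ _ _ _ := hom₂_ext fun x => by simp
  triangle _ _ := hom₂_ext fun x => by simp

end GrpdOver

/-! ### Relatively finite functors -/

/-- The full inverse image `F⁻¹(y)`: the full subgroupoid of `G` on the objects `x` with
`F x ≅ y`. -/
abbrev fullInverseImage {B : Type u} [Groupoid.{v} B] {G : Type u₁} [Groupoid.{v₁} G]
    (F : G ⥤ B) (y : B) : Type u₁ :=
  ObjectProperty.FullSubcategory (fun x : G => Nonempty (F.obj x ≅ y))

/-- `F` is relatively finite if every full inverse image is equivalent to a groupoid with
finitely many objects and finitely many morphisms. -/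
def IsRelativelyFinite {B : Type u} [Groupoid.{v} B] {G : Type u₁} [Groupoid.{v₁} G]
    (F : G ⥤ B) : Prop :=
  ∀ y : B, ∃ (D : Type u₁) (_ : Groupoid.{v₁} D),
    Finite D ∧ (∀ a b : D, Finite (a ⟶ b)) ∧ Nonempty (fullInverseImage F y ≌ D)

/-- The objects of `RelFin_B`: groupoids over `B` whose structure functor is relatively finite. -/
structure RelFin (B : Type u) [Groupoid.{v} B] extends GrpdOver.{v, u, v₁, u₁} B where
  isRelativelyFinite : IsRelativelyFinite functor

namespace RelFin

variable {B : Type u} [Groupoid.{v} B]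

instance categoryStruct : CategoryStruct (RelFin.{v, u, v₁, u₁} B) where
  Hom X Y := X.toGrpdOver ⟶ Y.toGrpdOver
  id X := 𝟙 X.toGrpdOver
  comp {X Y Z} (f : X.toGrpdOver ⟶ Y.toGrpdOver) (g : Y.toGrpdOver ⟶ Z.toGrpdOver) := f ≫ g

/-- The hom-groupoids of `RelFin_B` are those of the slice. -/
instance groupoidHom (X Y : RelFin.{v, u, v₁, u₁} B) : Groupoid (X ⟶ Y) :=
  inferInstanceAs (Groupoid (X.toGrpdOver ⟶ Y.toGrpdOver))

/-- `RelFin_B` as a full sub-(2,1)-category of the slice over `B`. -/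
instance bicategory : Bicategory (RelFin.{v, u, v₁, u₁} B) where
  homCategory X Y := (groupoidHom X Y).toCategory
  whiskerLeft {X Y Z} f g h a := GrpdOver.bicategory.whiskerLeft (a := X.toGrpdOver)
    (b := Y.toGrpdOver) (c := Z.toGrpdOver) f (g := g) (h := h) a
  whiskerRight {X Y Z} f g a h := GrpdOver.bicategory.whiskerRight (a := X.toGrpdOver)
    (b := Y.toGrpdOver) (c := Z.toGrpdOver) (f := f) (g := g) a h
  associator {W X Y Z} f g h := GrpdOver.bicategory.associator (a := W.toGrpdOver)
    (b := X.toGrpdOver) (c := Y.toGrpdOver) (d := Z.toGrpdOver) f g h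
  leftUnitor {X Y} f := GrpdOver.bicategory.leftUnitor (a := X.toGrpdOver) (b := Y.toGrpdOver) f
  rightUnitor {X Y} f := GrpdOver.bicategory.rightUnitor (a := X.toGrpdOver) (b := Y.toGrpdOver) f
  whiskerLeft_id _ _ := GrpdOver.bicategory.whiskerLeft_id _ _
  whiskerLeft_comp _ _ _ _ _ _ := GrpdOver.bicategory.whiskerLeft_comp _ _ _
  id_whiskerLeft _ := GrpdOver.bicategory.id_whiskerLeft _
  comp_whiskerLeft _ _ _ _ _ := GrpdOver.bicategory.comp_whiskerLeft _ _ _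
  id_whiskerRight _ _ := GrpdOver.bicategory.id_whiskerRight _ _
  comp_whiskerRight _ _ _ := GrpdOver.bicategory.comp_whiskerRight _ _ _
  whiskerRight_id _ := GrpdOver.bicategory.whiskerRight_id _
  whiskerRight_comp _ _ _ := GrpdOver.bicategory.whiskerRight_comp _ _ _
  whisker_assoc _ _ _ _ _ := GrpdOver.bicategory.whisker_assoc _ _ _
  whisker_exchange _ _ := GrpdOver.bicategory.whisker_exchange _ _
  pentagon _ _ _ _ := GrpdOver.bicategory.pentagon _ _ _ _
  triangle _ _ := GrpdOver.bicategory.triangle _ _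

/-- A relatively finite functor as an object of `RelFin_B`. -/
def of {G : Type u₁} [Groupoid.{v₁} G] (F : G ⥤ B) (hF : IsRelativelyFinite F) :
    RelFin.{v, u, v₁, u₁} B where
  carrier := G
  functor := F
  isRelativelyFinite := hF

end RelFin

/-! ### Functors out of deloopings of finite groups -/

/-- The delooping `BH` of a group `H` (Mathlib's `SingleObj H`), with its one-element set of
objects lifted to the universe of objects of `RelFin_B`; this is again a groupoid. -/
instance deloopingGroupoid (H : Type v₁) [Group H] :
    Groupoid.{v₁} (ULift.{u₁} (SingleObj H)) where
  toCategory := uliftCategory (SingleObj H)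
  inv {x y} f := (Groupoid.inv (show x.down ⟶ y.down from f) : y.down ⟶ x.down)
  inv_comp {x y} f := Groupoid.inv_comp (show x.down ⟶ y.down from f)
  comp_inv {x y} f := Groupoid.comp_inv (show x.down ⟶ y.down from f)

theorem isRelativelyFinite_of_finite_group {B : Type u} [Groupoid.{v} B] {H : Type v₁} [Group H]
    [Finite H] (S : SingleObj H ⥤ B) :
    IsRelativelyFinite (ULift.downFunctor.{v₁, 0, u₁} ⋙ S) := by
  intro y
  have hfin : Finite (fullInverseImage (ULift.downFunctor.{v₁, 0, u₁} ⋙ S) y) :=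
    Finite.of_injective (fun x => x.obj) (fun a b h => ObjectProperty.FullSubcategory.ext h)
  refine ⟨fullInverseImage (ULift.downFunctor.{v₁, 0, u₁} ⋙ S) y,
    InducedCategory.groupoid _ _, hfin, fun a b => ?_, ⟨.refl⟩⟩
  have : Finite (a.obj ⟶ b.obj) := inferInstanceAs (Finite H)
  exact Finite.of_injective (fun f : a ⟶ b => f.hom) (fun f g h => InducedCategory.hom_ext h)

/-- For a finite group `H`, a functor `S : BH ⥤ B` as an object of `RelFin_B`. -/
def RelFin.ofGroup {B : Type u} [Groupoid.{v} B] {H : Type v₁} [Group H] [Finite H]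
    (S : SingleObj H ⥤ B) : RelFin.{v, u, v₁, u₁} B :=
  RelFin.of (ULift.downFunctor ⋙ S) (isRelativelyFinite_of_finite_group S)

/-! A groupoid over `B` with finite automorphism groups is a family of finite groups acting on
objects of `B`, one for each connected component. For such a family `T` and a finite group `S` over
`B`, the groupoid `RelFin(S, F)` is the disjoint union of the action groupoids of `T i` on
`Hom(S, T i)`, where `T i` acts by conjugation. Hence its cardinality is
`∑ i, #Hom(S, T i) / #(T i)`.

A morphism out of `S` with kernel `N` is an injective morphism out of `S / N`. Splitting the sum
according to kernels, induction on the order of `S` shows that the cardinalities determine the sums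
`∑ i, #Inj(S, T i) / #(T i)` over injective morphisms. Here only the `T i` isomorphic to `S` and
those of larger order contribute. Over an object of `B` only finitely many orders occur, so
descending induction on the order of `S` recovers the number of `T i` isomorphic to `S`. A bijection
between the components which preserves isomorphism classes glues to an equivalence over `B`. -/

/-! ### Sums of extended nonnegative reals -/

theorem tsum_comp_eq_tsum_card_fiber_mul {α β : Type*} (f : α → β) (g : β → ℝ≥0∞) :
    ∑' a, g (f a) = ∑' b, (ENat.card { a // f a = b } : ℝ≥0∞) * g b := by
  rw [← ENNReal.tsum_fiberwise _ f]
  refine tsum_congr fun b => ?_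
  rw [← ENNReal.tsum_const]
  exact tsum_congr fun a => congrArg g a.2

theorem card_eq_tsum_card_fiber {α β : Type*} (f : α → β) :
    (ENat.card α : ℝ≥0∞) = ∑' b, (ENat.card { a // f a = b } : ℝ≥0∞) := by
  simpa only [ENNReal.tsum_one, mul_one] using tsum_comp_eq_tsum_card_fiber_mul f fun _ => 1

theorem apply_eq_of_tsum_eq_of_forall_ne {α : Type*} {f g : α → ℝ≥0∞} (a : α)
    (hsum : ∑' x, f x = ∑' x, g x) (hfin : ∑' x, f x ≠ ∞) (hne : ∀ x ≠ a, f x = g x) :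
    f a = g a := by
  classical
  rw [ENNReal.tsum_eq_add_tsum_ite a] at hsum hfin
  rw [ENNReal.tsum_eq_add_tsum_ite (f := g) a] at hsum
  have hrest : (∑' x, if x = a then 0 else f x) = ∑' x, if x = a then 0 else g x :=
    tsum_congr fun x => if_ctx_congr Iff.rfl (fun _ => rfl) (hne x)
  rw [← hrest] at hsum
  exact (ENNReal.add_left_inj (ENNReal.add_ne_top.1 hfin).2).1 hsum

/-! ### Groupoid cardinality of disjoint unions and of action groupoids -/

theorem groupoidCardinality_eq_tsum {C I : Type*} [Groupoid C] {D : I → Type*}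
    [∀ i, Groupoid (D i)] (Φ : ∀ i, D i ⥤ C) (hΦ : ∀ i, (Φ i).FullyFaithful)
    (hdisj : ∀ i j x y, Nonempty ((Φ i).obj x ≅ (Φ j).obj y) → i = j)
    (hsurj : ∀ c, ∃ i x, Nonempty ((Φ i).obj x ≅ c)) :
    groupoidCardinality C = ∑' i, groupoidCardinality (D i) := by
  let q : (Σ i, Quotient (isIsomorphicSetoid (D i))) → Quotient (isIsomorphicSetoid C) :=
    fun w => Quotient.map (Φ w.1).obj (fun _ _ => Nonempty.map (Φ w.1).mapIso) w.2
  have hq : Function.Bijective q := by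
    constructor
    · rintro ⟨i, ⟨x⟩⟩ ⟨j, ⟨y⟩⟩ h
      have hiso : Nonempty ((Φ i).obj x ≅ (Φ j).obj y) := Quotient.exact h
      obtain rfl := hdisj i j x y hiso
      exact congrArg (Sigma.mk i) (Quotient.sound (hiso.map (hΦ i).preimageIso))
    · rintro ⟨c⟩
      obtain ⟨i, x, h⟩ := hsurj c
      exact ⟨⟨i, ⟦x⟧⟩, Quotient.sound h⟩
  unfold groupoidCardinality
  rw [← (Equiv.ofBijective q hq).tsum_eq, ENNReal.tsum_sigma']
  refine tsum_congr fun i => tsum_congr ?_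
  rintro ⟨x⟩
  change (ENat.card (Aut ((Φ i).obj x)) : ℝ≥0∞)⁻¹ = (ENat.card (Aut x) : ℝ≥0∞)⁻¹
  rw [ENat.card_congr ((hΦ i).autMulEquivOfFullyFaithful x).toEquiv]

section ActionGroupoid

open ActionCategory MulAction

variable {A P : Type*} [Group A] [MulAction A P]

theorem nonempty_iso_objEquiv_iff (p q : P) :
    Nonempty (objEquiv A P p ≅ objEquiv A P q) ↔ p ∈ orbit A q := by
  have hhom : Nonempty (objEquiv A P p ⟶ objEquiv A P q) ↔ q ∈ orbit A p := nonempty_subtype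
  exact (Groupoid.isoEquivHom _ _).nonempty_congr.trans (hhom.trans mem_orbit_symm)

theorem card_aut_objEquiv (p : P) :
    ENat.card (Aut (objEquiv A P p)) = ENat.card (stabilizer A p) :=
  ENat.card_congr (Groupoid.isoEquivHom _ _)

theorem card_orbit_div_card [Finite A] (p : P) :
    (ENat.card (orbit A p) : ℝ≥0∞) / ENat.card A = (ENat.card (stabilizer A p) : ℝ≥0∞)⁻¹ := by
  have hcard : (ENat.card A : ℝ≥0∞) = ENat.card (orbit A p) * ENat.card (stabilizer A p) := by
    rw [← ENat.card_congr (orbitProdStabilizerEquivGroup A p), ENat.card_prod,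
      ENat.toENNReal_mul]
  have : Finite (orbit A p) := Finite.of_equiv _ (orbitEquivQuotientStabilizer A p).symm
  have : Nonempty (orbit A p) := (nonempty_orbit p).to_subtype
  have hzero : (ENat.card (orbit A p) : ℝ≥0∞) ≠ 0 :=
    ENat.toENNReal_eq_zero.not.2 ENat.card_ne_zero
  have htop : (ENat.card (orbit A p) : ℝ≥0∞) ≠ ∞ :=
    ENat.toENNReal_ne_top.2 ENat.card_lt_top_of_finite.ne
  rw [hcard, div_eq_mul_inv, ENNReal.mul_inv (.inl hzero) (.inl htop),
    ENNReal.mul_inv_cancel_left hzero htop]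

theorem groupoidCardinality_actionCategory [Finite A] :
    groupoidCardinality (ActionCategory A P) = ENat.card P / ENat.card A := by
  let cls (p : P) : Quotient (isIsomorphicSetoid (ActionCategory A P)) := ⟦objEquiv A P p⟧
  rw [card_eq_tsum_card_fiber cls, div_eq_mul_inv, ← ENNReal.tsum_mul_right]
  refine tsum_congr fun c => ?_
  obtain ⟨p, rfl⟩ : ∃ p, cls p = c := (Quotient.mk_surjective.comp (objEquiv A P).surjective) c
  have hfiber : { q // cls q = cls p } ≃ orbit A p :=
    Equiv.subtypeEquivRight fun q => Quotient.eq.trans (nonempty_iso_objEquiv_iff q p)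
  rw [ENat.card_congr hfiber, ← div_eq_mul_inv, card_orbit_div_card, ← card_aut_objEquiv]
  rfl

end ActionGroupoid

/-! ### Finite groups over a groupoid -/

/-- A finite group acting on an object of the groupoid `B`. This is a functor to `B` from the
delooping of a finite group, with the object and the action as separate fields. -/
structure FinGrpOver (B : Type u) [Groupoid.{v} B] where
  group : Type v₁
  [str : Group group]
  [fin : Finite group]
  obj : B
  action : group →* End obj

namespace FinGrpOver

attribute [instance] FinGrpOver.str FinGrpOver.fin

variable {B : Type u} [Groupoid.{v} B]

/-- A morphism of finite groups over `B`: a group homomorphism together with a morphism of the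
underlying objects which intertwines the actions along it. -/
@[ext]
structure Hom (S T : FinGrpOver.{v, u, v₁} B) where
  groupHom : S.group →* T.group
  objHom : S.obj ⟶ T.obj
  comm : ∀ h, (S.action h : S.obj ⟶ S.obj) ≫ objHom =
    objHom ≫ (T.action (groupHom h) : T.obj ⟶ T.obj)

instance category : Category (FinGrpOver.{v, u, v₁} B) where
  Hom S T := Hom S T
  id S :=
    { groupHom := MonoidHom.id S.group
      objHom := 𝟙 S.obj
      comm := fun h => by simp }
  comp f g :=
    { groupHom := g.groupHom.comp f.groupHom
      objHom := f.objHom ≫ g.objHom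
      comm := fun h => by
        rw [← Category.assoc, f.comm, Category.assoc, g.comm, Category.assoc,
          MonoidHom.comp_apply] }

@[ext]
theorem hom_ext {S T : FinGrpOver.{v, u, v₁} B} {f g : S ⟶ T} (hgroup : f.groupHom = g.groupHom)
    (hobj : f.objHom = g.objHom) : f = g :=
  Hom.ext hgroup hobj

theorem finite_hom (hB : IsLocallyFiniteGroupoid B) (S T : FinGrpOver.{v, u, v₁} B) :
    Finite (S ⟶ T) := by
  have := hB S.obj T.obj
  have : Finite (S.group →* T.group) := DFunLike.finite _
  refine Finite.of_injective (fun f : S ⟶ T => (f.groupHom, f.objHom)) fun f g h => ?_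
  exact hom_ext (congrArg Prod.fst h) (congrArg Prod.snd h)

def mulEquivOfIso {S T : FinGrpOver.{v, u, v₁} B} (e : S ≅ T) : S.group ≃* T.group :=
  MonoidHom.toMulEquiv e.hom.groupHom e.inv.groupHom
    (congrArg Hom.groupHom e.hom_inv_id) (congrArg Hom.groupHom e.inv_hom_id)

noncomputable def isoOfBijective {S T : FinGrpOver.{v, u, v₁} B} (f : S ⟶ T)
    (hf : Function.Bijective f.groupHom) : S ≅ T :=
  let φ : S.group ≃* T.group := MulEquiv.ofBijective f.groupHom hf
  { hom := f
    inv :=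
      { groupHom := φ.symm
        objHom := inv f.objHom
        comm := fun h => by
          have hφ : f.groupHom (φ.symm h) = h := φ.apply_symm_apply h
          rw [IsIso.comp_inv_eq, Category.assoc, MonoidHom.coe_coe, f.comm, hφ,
            IsIso.inv_hom_id_assoc] }
    hom_inv_id := hom_ext (MonoidHom.ext φ.symm_apply_apply) (IsIso.hom_inv_id f.objHom)
    inv_hom_id := hom_ext (MonoidHom.ext φ.apply_symm_apply) (IsIso.inv_hom_id f.objHom) }

theorem bijective_groupHom {S T : FinGrpOver.{v, u, v₁} B} (f : S ⟶ T) [IsIso f] :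
    Function.Bijective f.groupHom :=
  (mulEquivOfIso (asIso f)).bijective

theorem nonempty_iso_of_injective_of_card_le {S T : FinGrpOver.{v, u, v₁} B} (f : S ⟶ T)
    (hf : Function.Injective f.groupHom) (hcard : Nat.card T.group ≤ Nat.card S.group) :
    Nonempty (S ≅ T) :=
  ⟨isoOfBijective f (hf.bijective_of_nat_card_le hcard)⟩

theorem ker_groupHom_le {S T : FinGrpOver.{v, u, v₁} B} (f : S ⟶ T) :
    f.groupHom.ker ≤ S.action.ker := by
  intro h hh
  have hcomm := f.comm h
  rw [MonoidHom.mem_ker.1 hh, map_one, End.one_def, Category.comp_id] at hcomm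
  exact (cancel_mono_id f.objHom).1 hcomm

/-- The quotient of a finite group over `B` by a normal subgroup which acts trivially. -/
def quotient (S : FinGrpOver.{v, u, v₁} B) (N : Subgroup S.group) [N.Normal]
    (hN : N ≤ S.action.ker) : FinGrpOver.{v, u, v₁} B where
  group := S.group ⧸ N
  obj := S.obj
  action := QuotientGroup.lift N S.action hN

/-- The morphisms from `S` to `T` whose group homomorphism has kernel `N`. The choice `N = ⊥` gives
the morphisms which are injective on groups. -/
abbrev HomWithKer (S T : FinGrpOver.{v, u, v₁} B) (N : Subgroup S.group) : Type _ :=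
  { f : S ⟶ T // f.groupHom.ker = N }

theorem HomWithKer.injective {S T : FinGrpOver.{v, u, v₁} B} (f : HomWithKer S T ⊥) :
    Function.Injective f.1.groupHom :=
  (MonoidHom.ker_eq_bot_iff _).1 f.2

noncomputable def homWithKerCongr (S : FinGrpOver.{v, u, v₁} B) {T U : FinGrpOver.{v, u, v₁} B}
    (e : T ≅ U) (N : Subgroup S.group) : HomWithKer S T N ≃ HomWithKer S U N :=
  (e.homToEquiv (Z := S)).subtypeEquiv fun f => by
    have hker : (e.hom.groupHom.comp f.groupHom).ker = f.groupHom.ker :=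
      MonoidHom.ker_comp_of_injective _ _ (bijective_groupHom e.hom).injective
    rw [← hker]
    rfl

def quotientHomWithKerEquiv (S T : FinGrpOver.{v, u, v₁} B) (N : Subgroup S.group) [N.Normal]
    (hN : N ≤ S.action.ker) : HomWithKer (S.quotient N hN) T ⊥ ≃ HomWithKer S T N where
  toFun f :=
    { val :=
        { groupHom := f.1.groupHom.comp (QuotientGroup.mk' N)
          objHom := f.1.objHom
          comm := fun h => f.1.comm (QuotientGroup.mk' N h) }
      property := (MonoidHom.ker_comp_of_injective (QuotientGroup.mk' N) f.1.groupHom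
        f.injective).trans (QuotientGroup.ker_mk' N) }
  invFun f :=
    { val :=
        { groupHom := QuotientGroup.lift N f.1.groupHom f.2.ge
          objHom := f.1.objHom
          comm := fun h => QuotientGroup.induction_on h f.1.comm }
      property := by
        change (QuotientGroup.lift N f.1.groupHom f.2.ge).ker = ⊥
        rw [QuotientGroup.ker_lift, f.2, QuotientGroup.map_mk'_self] }
  left_inv _ := Subtype.ext (hom_ext (QuotientGroup.monoidHom_ext _ rfl) rfl)
  right_inv _ := rfl

theorem card_group_quotient_lt (S : FinGrpOver.{v, u, v₁} B) {N : Subgroup S.group} [N.Normal]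
    (hN : N ≤ S.action.ker) (hne : N ≠ ⊥) :
    Nat.card (S.quotient N hN).group < Nat.card S.group := by
  change Nat.card (S.group ⧸ N) < Nat.card S.group
  rw [N.card_eq_card_quotient_mul_card_subgroup]
  exact lt_mul_of_one_lt_right Nat.card_pos (N.one_lt_card_iff_ne_bot.2 hne)

/-! ### Weighted counts of morphisms into a family -/

section Mass

variable {I J : Type*}

/-- The number of morphisms from `S` to the members of the family `T`, each counted with the inverse
of the order of the target group as its weight. -/
noncomputable def homMass (T : I → FinGrpOver.{v, u, v₁} B) (S : FinGrpOver.{v, u, v₁} B) : ℝ≥0∞ :=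
  ∑' i, (ENat.card (S ⟶ T i) : ℝ≥0∞) / ENat.card (T i).group

/-- The part of `homMass T S` which comes from the morphisms with kernel `N`. -/
noncomputable def kerMass (T : I → FinGrpOver.{v, u, v₁} B) (S : FinGrpOver.{v, u, v₁} B)
    (N : Subgroup S.group) : ℝ≥0∞ :=
  ∑' i, (ENat.card (HomWithKer S (T i) N) : ℝ≥0∞) / ENat.card (T i).group

/-- A family of finite groups over `B` is relatively finite if only finitely many of its members
lie over any given isomorphism class of objects of `B`. -/
def IsRelativelyFiniteFamily (T : I → FinGrpOver.{v, u, v₁} B) : Prop :=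
  ∀ y : B, { i | Nonempty ((T i).obj ⟶ y) }.Finite

theorem card_div_card_group_ne_top (α : Type*) [Finite α] (T : FinGrpOver.{v, u, v₁} B) :
    (ENat.card α : ℝ≥0∞) / ENat.card T.group ≠ ∞ :=
  ENNReal.div_ne_top (ENat.toENNReal_ne_top.2 ENat.card_lt_top_of_finite.ne)
    (ENat.toENNReal_eq_zero.not.2 ENat.card_ne_zero)

theorem card_div_card_group_eq_zero (α : Type*) [IsEmpty α] (T : FinGrpOver.{v, u, v₁} B) :
    (ENat.card α : ℝ≥0∞) / ENat.card T.group = 0 := by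
  have hcard : ENat.card α = 0 := (ENat.card_eq_zero_iff_empty α).2 inferInstance
  rw [hcard, ENat.toENNReal_zero, ENNReal.zero_div]

theorem homMass_ne_top (hB : IsLocallyFiniteGroupoid B) {T : I → FinGrpOver.{v, u, v₁} B}
    (hT : IsRelativelyFiniteFamily T) (S : FinGrpOver.{v, u, v₁} B) : homMass T S ≠ ∞ := by
  have hzero : ∀ i ∉ (hT S.obj).toFinset,
      (ENat.card (S ⟶ T i) : ℝ≥0∞) / ENat.card (T i).group = 0 := fun i hi => by
    have : IsEmpty (S ⟶ T i) := ⟨fun f => hi ((hT S.obj).mem_toFinset.2 ⟨inv f.objHom⟩)⟩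
    exact card_div_card_group_eq_zero (S ⟶ T i) (T i)
  rw [homMass, tsum_eq_sum hzero]
  refine ENNReal.sum_ne_top.2 fun i _ => ?_
  have := finite_hom hB S (T i)
  exact card_div_card_group_ne_top _ (T i)

theorem homMass_eq_tsum_kerMass (T : I → FinGrpOver.{v, u, v₁} B) (S : FinGrpOver.{v, u, v₁} B) :
    homMass T S = ∑' N, kerMass T S N := by
  simp only [homMass, kerMass, div_eq_mul_inv]
  rw [ENNReal.tsum_comm]
  refine tsum_congr fun i => ?_
  rw [ENNReal.tsum_mul_right, card_eq_tsum_card_fiber fun f : S ⟶ T i => f.groupHom.ker]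

theorem kerMass_ne_top (hB : IsLocallyFiniteGroupoid B) {T : I → FinGrpOver.{v, u, v₁} B}
    (hT : IsRelativelyFiniteFamily T) (S : FinGrpOver.{v, u, v₁} B) (N : Subgroup S.group) :
    kerMass T S N ≠ ∞ :=
  ne_top_of_le_ne_top (homMass_eq_tsum_kerMass T S ▸ homMass_ne_top hB hT S) (ENNReal.le_tsum N)

theorem kerMass_eq_kerMass_quotient_bot (T : I → FinGrpOver.{v, u, v₁} B)
    (S : FinGrpOver.{v, u, v₁} B) (N : Subgroup S.group) [N.Normal] (hN : N ≤ S.action.ker) :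
    kerMass T S N = kerMass T (S.quotient N hN) ⊥ :=
  tsum_congr fun i => by rw [ENat.card_congr (quotientHomWithKerEquiv S (T i) N hN)]

theorem kerMass_eq_zero (T : I → FinGrpOver.{v, u, v₁} B) (S : FinGrpOver.{v, u, v₁} B)
    (N : Subgroup S.group) (hN : ¬(N.Normal ∧ N ≤ S.action.ker)) : kerMass T S N = 0 := by
  refine ENNReal.tsum_eq_zero.2 fun i => ?_
  have : IsEmpty (HomWithKer S (T i) N) :=
    ⟨fun f => hN (f.2 ▸ ⟨inferInstance, ker_groupHom_le f.1⟩)⟩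
  exact card_div_card_group_eq_zero (HomWithKer S (T i) N) (T i)

theorem kerMass_bot_eq_of_homMass_eq (hB : IsLocallyFiniteGroupoid B)
    {T : I → FinGrpOver.{v, u, v₁} B} {T' : J → FinGrpOver.{v, u, v₁} B}
    (hT : IsRelativelyFiniteFamily T) (hmass : ∀ S, homMass T S = homMass T' S)
    (S : FinGrpOver.{v, u, v₁} B) : kerMass T S ⊥ = kerMass T' S ⊥ := by
  induction hn : Nat.card S.group using Nat.strong_induction_on generalizing S with
  | _ n ih =>
  subst hn
  have hsum := hmass S
  have htop := homMass_ne_top hB hT S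
  simp only [homMass_eq_tsum_kerMass] at hsum htop
  refine apply_eq_of_tsum_eq_of_forall_ne ⊥ hsum htop fun N hN => ?_
  by_cases h : N.Normal ∧ N ≤ S.action.ker
  · obtain ⟨_, hle⟩ := h
    rw [kerMass_eq_kerMass_quotient_bot T S N hle, kerMass_eq_kerMass_quotient_bot T' S N hle]
    exact ih _ (S.card_group_quotient_lt hle hN) _ rfl
  · rw [kerMass_eq_zero T S N h, kerMass_eq_zero T' S N h]

/-- The number of members of the family `T` in the isomorphism class `c`. -/
noncomputable def multiplicity (T : I → FinGrpOver.{v, u, v₁} B)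
    (c : Quotient (isIsomorphicSetoid (FinGrpOver.{v, u, v₁} B))) : ℕ∞ :=
  ENat.card { i // ⟦T i⟧ = c }

/-- The contribution of a single member of the isomorphism class `c` to `kerMass T S ⊥`. -/
noncomputable def classWeight (S : FinGrpOver.{v, u, v₁} B)
    (c : Quotient (isIsomorphicSetoid (FinGrpOver.{v, u, v₁} B))) : ℝ≥0∞ :=
  Quotient.lift
    (fun T : FinGrpOver.{v, u, v₁} B =>
      (ENat.card (HomWithKer S T ⊥) : ℝ≥0∞) / ENat.card T.group)
    (by
      rintro T U ⟨e⟩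
      simp only [ENat.card_congr (homWithKerCongr S e ⊥),
        ENat.card_congr (mulEquivOfIso e).toEquiv]) c

theorem kerMass_bot_eq_tsum_multiplicity_mul_classWeight (T : I → FinGrpOver.{v, u, v₁} B)
    (S : FinGrpOver.{v, u, v₁} B) :
    kerMass T S ⊥ = ∑' c, (multiplicity T c : ℝ≥0∞) * classWeight S c :=
  tsum_comp_eq_tsum_card_fiber_mul (fun i => ⟦T i⟧) (classWeight S)

theorem classWeight_mk_eq_zero {S T : FinGrpOver.{v, u, v₁} B} [IsEmpty (HomWithKer S T ⊥)] :
    classWeight S ⟦T⟧ = 0 :=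
  card_div_card_group_eq_zero (HomWithKer S T ⊥) T

theorem classWeight_self_ne_zero (S : FinGrpOver.{v, u, v₁} B) : classWeight S ⟦S⟧ ≠ 0 := by
  have : Nonempty (HomWithKer S S ⊥) := ⟨𝟙 S, MonoidHom.ker_id⟩
  refine ENNReal.div_ne_zero.2 ⟨ENat.toENNReal_eq_zero.not.2 ENat.card_ne_zero, ?_⟩
  exact ENat.toENNReal_ne_top.2 ENat.card_lt_top_of_finite.ne

theorem classWeight_self_ne_top (hB : IsLocallyFiniteGroupoid B) (S : FinGrpOver.{v, u, v₁} B) :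
    classWeight S ⟦S⟧ ≠ ∞ := by
  have := finite_hom hB S S
  exact card_div_card_group_ne_top (HomWithKer S S ⊥) S

theorem multiplicity_eq_of_forall_card_lt (hB : IsLocallyFiniteGroupoid B)
    {T : I → FinGrpOver.{v, u, v₁} B} {T' : J → FinGrpOver.{v, u, v₁} B}
    (hT : IsRelativelyFiniteFamily T) (S : FinGrpOver.{v, u, v₁} B)
    (hker : kerMass T S ⊥ = kerMass T' S ⊥)
    (hlt : ∀ U : FinGrpOver.{v, u, v₁} B, Nonempty (S ⟶ U) →
      Nat.card S.group < Nat.card U.group → multiplicity T ⟦U⟧ = multiplicity T' ⟦U⟧) :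
    multiplicity T ⟦S⟧ = multiplicity T' ⟦S⟧ := by
  have htop := kerMass_ne_top hB hT S ⊥
  simp only [kerMass_bot_eq_tsum_multiplicity_mul_classWeight] at hker htop
  have hterm := apply_eq_of_tsum_eq_of_forall_ne ⟦S⟧ hker htop ?_
  · exact ENat.toENNReal_inj.1 ((ENNReal.mul_left_inj (classWeight_self_ne_zero S)
      (classWeight_self_ne_top hB S)).1 hterm)
  rintro ⟨U⟩ hU
  change (multiplicity T ⟦U⟧ : ℝ≥0∞) * classWeight S ⟦U⟧ = multiplicity T' ⟦U⟧ * classWeight S ⟦U⟧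
  obtain _ | ⟨⟨f⟩⟩ := isEmpty_or_nonempty (HomWithKer S U ⊥)
  · simp only [classWeight_mk_eq_zero, mul_zero]
  · have hcard : Nat.card S.group < Nat.card U.group := by
      by_contra! hle
      obtain ⟨e⟩ := nonempty_iso_of_injective_of_card_le f.1 f.injective hle
      exact hU (Quotient.sound ⟨e.symm⟩)
    rw [hlt U ⟨f.1⟩ hcard]

theorem exists_forall_multiplicity_eq_zero {T : I → FinGrpOver.{v, u, v₁} B}
    (hT : IsRelativelyFiniteFamily T) (y : B) :
    ∃ M : ℕ, ∀ S : FinGrpOver.{v, u, v₁} B, Nonempty (S.obj ⟶ y) → M < Nat.card S.group →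
      multiplicity T ⟦S⟧ = 0 := by
  obtain ⟨M, hM⟩ := ((hT y).image fun i => Nat.card (T i).group).bddAbove
  refine ⟨M, fun S ⟨k⟩ hS => (ENat.card_eq_zero_iff_empty _).2 ⟨fun ⟨i, hi⟩ => hS.not_ge ?_⟩⟩
  obtain ⟨e⟩ := Quotient.exact hi
  rw [← Nat.card_congr (mulEquivOfIso e).toEquiv]
  exact hM ⟨i, ⟨e.hom.objHom ≫ k⟩, rfl⟩

theorem multiplicity_eq_of_kerMass_bot_eq (hB : IsLocallyFiniteGroupoid B)
    {T : I → FinGrpOver.{v, u, v₁} B} {T' : J → FinGrpOver.{v, u, v₁} B}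
    (hT : IsRelativelyFiniteFamily T) (hT' : IsRelativelyFiniteFamily T')
    (hker : ∀ S, kerMass T S ⊥ = kerMass T' S ⊥)
    (c : Quotient (isIsomorphicSetoid (FinGrpOver.{v, u, v₁} B))) :
    multiplicity T c = multiplicity T' c := by
  obtain ⟨S⟩ := c
  obtain ⟨M, hM⟩ := exists_forall_multiplicity_eq_zero hT S.obj
  obtain ⟨M', hM'⟩ := exists_forall_multiplicity_eq_zero hT' S.obj
  suffices hdesc : ∀ (k : ℕ) (U : FinGrpOver.{v, u, v₁} B), Nonempty (U.obj ⟶ S.obj) →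
      max M M' < Nat.card U.group + k → multiplicity T ⟦U⟧ = multiplicity T' ⟦U⟧ from
    hdesc (max M M' + 1) S ⟨𝟙 S.obj⟩ (by lia)
  intro k
  induction k with
  | zero => exact fun U hU hk => (hM U hU (by lia)).trans (hM' U hU (by lia)).symm
  | succ k ih =>
    rintro U ⟨m⟩ hk
    refine multiplicity_eq_of_forall_card_lt hB hT U (hker U) fun V ⟨f⟩ hV => ?_
    exact ih V ⟨inv f.objHom ≫ m⟩ (by lia)

theorem finite_fiber {T : I → FinGrpOver.{v, u, v₁} B} (hT : IsRelativelyFiniteFamily T)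
    (c : Quotient (isIsomorphicSetoid (FinGrpOver.{v, u, v₁} B))) : Finite { i // ⟦T i⟧ = c } := by
  obtain ⟨S⟩ := c
  refine ((hT S.obj).subset fun i hi => ?_).to_subtype
  obtain ⟨e⟩ := Quotient.exact hi
  exact ⟨e.hom.objHom⟩

theorem exists_equiv_of_homMass_eq (hB : IsLocallyFiniteGroupoid B)
    {T : I → FinGrpOver.{v, u, v₁} B} {T' : J → FinGrpOver.{v, u, v₁} B}
    (hT : IsRelativelyFiniteFamily T) (hT' : IsRelativelyFiniteFamily T')
    (hmass : ∀ S, homMass T S = homMass T' S) :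
    ∃ e : I ≃ J, ∀ i, Nonempty (T i ≅ T' (e i)) := by
  have hmult := multiplicity_eq_of_kerMass_bot_eq hB hT hT'
    (kerMass_bot_eq_of_homMass_eq hB hT hmass)
  have hfiber (c : Quotient (isIsomorphicSetoid (FinGrpOver.{v, u, v₁} B))) :
      Nonempty ({ i // ⟦T i⟧ = c } ≃ { j // ⟦T' j⟧ = c }) := by
    have := finite_fiber hT c
    have := finite_fiber hT' c
    have hcard := hmult c
    rw [multiplicity, multiplicity, ENat.card_eq_coe_natCard, ENat.card_eq_coe_natCard,
      Nat.cast_inj] at hcard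
    exact Finite.card_eq.1 hcard
  exact ⟨Equiv.ofFiberEquiv fun c => (hfiber c).some, fun i =>
    Quotient.exact (Equiv.ofFiberEquiv_map (fun c => (hfiber c).some) i).symm⟩

end Mass

/-! ### The action groupoids of morphisms and the hom-groupoids of `RelFin B` -/

/-- An element of the group acts by endomorphisms on its finite group over `B`, by conjugation on
the group and by the given action on the object. -/
def conjEnd (T : FinGrpOver.{v, u, v₁} B) : T.group →* End T where
  toFun g :=
    { groupHom := (MulAut.conj g).toMonoidHom
      objHom := T.action g
      comm := fun h => by
        change T.action g * T.action h = T.action (g * h * g⁻¹) * T.action g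
        rw [← map_mul, ← map_mul, inv_mul_cancel_right] }
  map_one' := hom_ext (congrArg MulEquiv.toMonoidHom (map_one MulAut.conj)) (map_one T.action)
  map_mul' g g' := hom_ext (congrArg MulEquiv.toMonoidHom (map_mul MulAut.conj g g'))
    (map_mul T.action g g')

instance homMulAction (S T : FinGrpOver.{v, u, v₁} B) : MulAction T.group (S ⟶ T) :=
  MulAction.compHom (S ⟶ T) (conjEnd T)

theorem smul_eq_iff {S T : FinGrpOver.{v, u, v₁} B} (g : T.group) (f f' : S ⟶ T) :
    g • f = f' ↔ (∀ h, g * f.groupHom h = f'.groupHom h * g) ∧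
      f.objHom ≫ (T.action g : T.obj ⟶ T.obj) = f'.objHom := by
  rw [Hom.ext_iff, MonoidHom.ext_iff]
  refine and_congr (forall_congr' fun h => ?_) Iff.rfl
  change g * f.groupHom h * g⁻¹ = _ ↔ _
  exact mul_inv_eq_iff_eq_mul

section OfObj

variable {G : Type u₁} [Groupoid.{v₁} G] [∀ x : G, Finite (End x)] {F : G ⥤ B}
  {hF : IsRelativelyFinite F} {S : FinGrpOver.{v, u, v₁} B} {x y : G}

/-- The endomorphism group of `x` acting on the image of `x` in `B`. -/
def ofObj (F : G ⥤ B) (x : G) : FinGrpOver.{v, u, v₁} B where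
  group := End x
  obj := F.obj x
  action := F.mapEnd x

/-- The morphism of finite groups over `B` given by conjugation by `k` and by the image of `k`. -/
def ofObjMap (F : G ⥤ B) (k : x ≅ y) : ofObj F x ⟶ ofObj F y where
  groupHom := k.conj.toMonoidHom
  objHom := F.map k.hom
  comm h := by
    change F.map h ≫ F.map k.hom = F.map k.hom ≫ F.map (k.inv ≫ h ≫ k.hom)
    rw [← F.map_comp, k.hom_inv_id_assoc]
    exact (F.map_comp h k.hom).symm

/-- The 1-morphism of `RelFin B` which sends the point to `x` and is given by `f` on
automorphisms. -/
def toRelFinHom (hF : IsRelativelyFinite F) (f : S ⟶ ofObj F x) :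
    RelFin.ofGroup (SingleObj.functor S.action) ⟶ RelFin.of F hF :=
  GrpdOver.Hom.mk (X := (RelFin.ofGroup (SingleObj.functor S.action)).toGrpdOver)
    (Y := (RelFin.of F hF).toGrpdOver)
    (ULift.downFunctor ⋙ SingleObj.functor (X := x) f.groupHom)
    (NatIso.ofComponents (fun _ => (Groupoid.isoEquivHom S.obj (F.obj x)).symm f.objHom)
      fun h => f.comm h)

def toRelFinHomHomEquiv (f : S ⟶ ofObj F x) (g : S ⟶ ofObj F y) :
    (toRelFinHom hF f ⟶ toRelFinHom hF g) ≃
      { k : x ⟶ y // (∀ h, (f.groupHom h : x ⟶ x) ≫ k = k ≫ (g.groupHom h : y ⟶ y)) ∧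
        f.objHom ≫ F.map k = g.objHom } where
  toFun a :=
    { val := (GrpdOver.Hom₂.natTrans a).app ⟨SingleObj.star _⟩
      property :=
        ⟨fun h => (GrpdOver.Hom₂.natTrans a).naturality (X := ⟨SingleObj.star _⟩)
          (Y := ⟨SingleObj.star _⟩) h, GrpdOver.hom₂_w_app a ⟨SingleObj.star _⟩⟩ }
  invFun k := GrpdOver.mkHom₂ (X := (RelFin.ofGroup (SingleObj.functor S.action)).toGrpdOver)
    (Y := (RelFin.of F hF).toGrpdOver) (toRelFinHom hF f) (toRelFinHom hF g)
    { app := fun _ => k.1, naturality := fun _ _ h => k.2.1 h } fun _ => k.2.2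
  left_inv _ := GrpdOver.hom₂_ext fun _ => rfl
  right_inv _ := rfl

theorem nonempty_toRelFinHom_comp_ofObjMap_iso (f : S ⟶ ofObj F x) (k : x ≅ y) :
    Nonempty (toRelFinHom hF (f ≫ ofObjMap F k) ≅ toRelFinHom hF f) := by
  refine ⟨(GrpdOver.isoOfHom₂ ((toRelFinHomHomEquiv _ _).symm ⟨k.hom, fun h => ?_, rfl⟩)).symm⟩
  exact (k.hom_inv_id_assoc _).symm

/-- The value of a 1-morphism out of the delooping of a group at the point, together with its effect
on automorphisms. -/
def evalPoint (a : RelFin.ofGroup (SingleObj.functor S.action) ⟶ RelFin.of F hF) :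
    S ⟶ ofObj F ((GrpdOver.Hom.functor a).obj ⟨SingleObj.star S.group⟩) where
  groupHom := (GrpdOver.Hom.functor a).mapEnd (⟨SingleObj.star S.group⟩ : ULift _)
  objHom := (GrpdOver.Hom.iso a).hom.app ⟨SingleObj.star S.group⟩
  comm h := (GrpdOver.Hom.iso a).hom.naturality (X := ⟨SingleObj.star S.group⟩)
    (Y := ⟨SingleObj.star S.group⟩) h

theorem nonempty_toRelFinHom_evalPoint_iso
    (a : RelFin.ofGroup (SingleObj.functor S.action) ⟶ RelFin.of F hF) :
    Nonempty (toRelFinHom hF (evalPoint a) ≅ a) :=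
  ⟨GrpdOver.isoOfHom₂ (GrpdOver.mkHom₂
    (X := (RelFin.ofGroup (SingleObj.functor S.action)).toGrpdOver)
    (Y := (RelFin.of F hF).toGrpdOver) (toRelFinHom hF (evalPoint a)) a
    { app := fun _ => 𝟙 _
      naturality := fun _ _ _ => (Category.comp_id _).trans (Category.id_comp _).symm } fun _ => by
        exact (congrArg _ (F.map_id _)).trans (Category.comp_id _))⟩

variable (hF S x)

/-- The action groupoid of the endomorphisms of `x` on the morphisms from `S` to `ofObj F x`,
embedded in the groupoid of 1-morphisms of `RelFin B`. -/
def toRelFinHomFunctor : ActionCategory (ofObj F x).group (S ⟶ ofObj F x) ⥤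
      (RelFin.ofGroup (SingleObj.functor S.action) ⟶ RelFin.of F hF) where
  obj f := toRelFinHom hF f.back
  map {f g} k := (toRelFinHomHomEquiv f.back g.back).symm
    ⟨k.1, (smul_eq_iff (T := ofObj F x) k.1 f.back g.back).1 k.2⟩
  map_id _ := GrpdOver.hom₂_ext fun _ => rfl
  map_comp _ _ := GrpdOver.hom₂_ext fun _ => rfl

def toRelFinHomFunctorFullyFaithful : (toRelFinHomFunctor hF S x).FullyFaithful where
  preimage {f g} a :=
    ⟨(toRelFinHomHomEquiv f.back g.back a).1,
      (smul_eq_iff (T := ofObj F x) _ f.back g.back).2 (toRelFinHomHomEquiv f.back g.back a).2⟩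
  map_preimage {f g} := (toRelFinHomHomEquiv f.back g.back).symm_apply_apply
  preimage_map _ := rfl

end OfObj

section Component

variable {G : Type u₁} [Groupoid.{v₁} G] [∀ x : G, Finite (End x)]

/-- The connected component `c` of `G`, as a finite group over `B`. -/
noncomputable def component (F : G ⥤ B) (c : Quotient (isIsomorphicSetoid G)) :
    FinGrpOver.{v, u, v₁} B :=
  ofObj F c.out

theorem groupoidCardinality_hom_ofGroup (F : G ⥤ B) (hF : IsRelativelyFinite F)
    (S : FinGrpOver.{v, u, v₁} B) :
    groupoidCardinality (RelFin.ofGroup (SingleObj.functor S.action) ⟶ RelFin.of F hF) =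
      homMass (component F) S := by
  rw [groupoidCardinality_eq_tsum
    (fun c : Quotient (isIsomorphicSetoid G) => toRelFinHomFunctor hF S c.out)
    fun c => toRelFinHomFunctorFullyFaithful hF S c.out]
  · exact tsum_congr fun c => groupoidCardinality_actionCategory (A := (ofObj F c.out).group)
  · rintro c d f g ⟨e⟩
    exact Quotient.out_equiv_out.1 ⟨asIso (toRelFinHomHomEquiv f.back g.back e.hom).1⟩
  · intro a
    let x : G := (GrpdOver.Hom.functor a).obj ⟨SingleObj.star S.group⟩
    obtain ⟨k⟩ : Nonempty (x ≅ (⟦x⟧ : Quotient (isIsomorphicSetoid G)).out) :=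
      (Quotient.mk_out (s := isIsomorphicSetoid G) x).map Iso.symm
    obtain ⟨e⟩ := nonempty_toRelFinHom_evalPoint_iso a
    obtain ⟨e'⟩ := nonempty_toRelFinHom_comp_ofObjMap_iso (hF := hF) (evalPoint a) k
    exact ⟨⟦x⟧, ActionCategory.objEquiv _ _ (evalPoint a ≫ ofObjMap F k), ⟨e' ≪≫ e⟩⟩

end Component

end FinGrpOver

/-! ### Finiteness of the components -/

section Finiteness

variable {B : Type u} [Groupoid.{v} B] {G : Type u₁} [Groupoid.{v₁} G] {F : G ⥤ B}

theorem IsRelativelyFinite.finite_end (hF : IsRelativelyFinite F) (x : G) : Finite (End x) := by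
  obtain ⟨D, _, -, hhom, ⟨e⟩⟩ := hF (F.obj x)
  let X : fullInverseImage F (F.obj x) := ⟨x, ⟨Iso.refl _⟩⟩
  have := hhom (e.functor.obj X) (e.functor.obj X)
  exact Finite.of_injective (fun k : x ⟶ x => e.functor.map (InducedCategory.homMk k : X ⟶ X))
    fun k l h => congrArg InducedCategory.Hom.hom (e.functor.map_injective h)

theorem IsRelativelyFinite.isRelativelyFiniteFamily_component [∀ x : G, Finite (End x)]
    (hF : IsRelativelyFinite F) :
    FinGrpOver.IsRelativelyFiniteFamily (FinGrpOver.component F) := by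
  intro y
  obtain ⟨D, _, _, -, ⟨e⟩⟩ := hF y
  let X : { c | Nonempty ((FinGrpOver.component F c).obj ⟶ y) } → fullInverseImage F y := fun c =>
    ⟨c.1.out, c.2.map (Groupoid.isoEquivHom _ _).symm⟩
  refine Set.finite_coe_iff.1 (Finite.of_injective (fun c => e.functor.obj (X c)) fun c d h => ?_)
  let k : X c ≅ X d := e.functor.preimageIso (eqToIso h)
  exact Subtype.ext (Quotient.out_equiv_out.1 ⟨(ObjectProperty.ι _).mapIso k⟩)

end Finiteness

/-! ### Equivalences of groupoids over `B` -/

namespace GrpdOver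

variable {B : Type u} [Groupoid.{v} B] {X Y : GrpdOver.{v, u, v₁, u₁} B}
  (E : X.carrier ≌ Y.carrier) (η : X.functor ≅ E.functor ⋙ Y.functor)

def homOfEquivalence : X ⟶ Y :=
  Hom.mk E.functor η

def invOfEquivalence : Y ⟶ X :=
  Hom.mk E.inverse (Y.functor.leftUnitor.symm ≪≫
    Functor.isoWhiskerRight E.counitIso.symm Y.functor ≪≫ Functor.associator _ _ _ ≪≫
      Functor.isoWhiskerLeft E.inverse η.symm)

theorem invOfEquivalence_iso_hom_app (y : Y.carrier) :
    (Hom.iso (invOfEquivalence E η)).hom.app y =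
      Y.functor.map (E.counitInv.app y) ≫ η.inv.app (E.inverse.obj y) := by
  simp [invOfEquivalence]

def unitOfEquivalence : 𝟙 X ≅ homOfEquivalence E η ≫ invOfEquivalence E η :=
  isoOfHom₂ (mkHom₂ _ _ E.unit fun x => by
    have hη : X.functor.map (E.unit.app x) ≫ η.hom.app _ =
        η.hom.app x ≫ Y.functor.map (E.functor.map (E.unit.app x)) :=
      η.hom.naturality (E.unit.app x)
    rw [id_iso_hom_app, Category.id_comp, comp_iso_hom_app, invOfEquivalence_iso_hom_app]
    change _ = η.hom.app x ≫ Y.functor.map (E.counitInv.app (E.functor.obj x)) ≫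
      η.inv.app _
    rw [E.counitInv_app_functor, ← Category.assoc]
    exact (Iso.eq_comp_inv (η.app _)).2 hη)

def counitOfEquivalence : invOfEquivalence E η ≫ homOfEquivalence E η ≅ 𝟙 Y :=
  isoOfHom₂ (mkHom₂ _ _ E.counit fun y => by
    rw [id_iso_hom_app, comp_iso_hom_app, invOfEquivalence_iso_hom_app]
    change ((_ ≫ η.inv.app _) ≫ η.hom.app _) ≫ Y.functor.map (E.counit.app y) = 𝟙 _
    simp)

end GrpdOver

namespace RelFin

variable {B : Type u} [Groupoid.{v} B]

theorem nonempty_equivalence {X Y : RelFin.{v, u, v₁, u₁} B} (E : X.carrier ≌ Y.carrier)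
    (η : X.functor ≅ E.functor ⋙ Y.functor) : Nonempty (Bicategory.Equivalence X Y) :=
  ⟨Bicategory.Equivalence.mkOfAdjointifyCounit (B := RelFin.{v, u, v₁, u₁} B)
    (f := GrpdOver.homOfEquivalence E η) (g := GrpdOver.invOfEquivalence E η)
    (GrpdOver.unitOfEquivalence E η) (GrpdOver.counitOfEquivalence E η)⟩

theorem nonempty_equivalence_of_span {C : Type*} [Category* C] {G G' : Type u₁}
    [Groupoid.{v₁} G] [Groupoid.{v₁} G'] {F : G ⥤ B} {F' : G' ⥤ B}
    (hF : IsRelativelyFinite F) (hF' : IsRelativelyFinite F')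
    (K : C ⥤ G) (L : C ⥤ G') [K.IsEquivalence] [L.IsEquivalence] (θ : K ⋙ F ≅ L ⋙ F') :
    Nonempty (Bicategory.Equivalence (RelFin.of F hF) (RelFin.of F' hF')) :=
  nonempty_equivalence (X := RelFin.of F hF) (Y := RelFin.of F' hF')
    (K.asEquivalence.symm.trans L.asEquivalence)
    (F.leftUnitor.symm ≪≫ Functor.isoWhiskerRight K.asEquivalence.counitIso.symm F ≪≫
      Functor.associator _ _ _ ≪≫ Functor.isoWhiskerLeft K.inv θ ≪≫
      (Functor.associator _ _ _).symm)

end RelFin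

section Components

variable {I : Type*} {A : I → Type*} [∀ i, Group (A i)] {G : Type*} [Groupoid G]

/-- The functor from the disjoint union of the deloopings of the groups `A i` which sends the `i`-th
point to `r i` and is given by `φ i` on automorphisms. -/
abbrev componentsFunctor (r : I → G) (φ : ∀ i, A i →* End (r i)) :
    (Σ i, SingleObj (A i)) ⥤ G :=
  Sigma.desc fun i => SingleObj.functor (φ i)

theorem componentsFunctor_isEquivalence (r : I → G) (φ : ∀ i, A i →* End (r i))
    (hr : ∀ i j, Nonempty (r i ≅ r j) → i = j) (hsurj : ∀ x : G, ∃ i, Nonempty (r i ≅ x))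
    (hφ : ∀ i, Function.Bijective (φ i)) : (componentsFunctor r φ).IsEquivalence where
  faithful := ⟨by
    rintro ⟨i, x⟩ ⟨j, y⟩ ⟨f⟩ ⟨g⟩ h
    exact congrArg Sigma.SigmaHom.mk ((hφ i).injective h)⟩
  full := ⟨by
    rintro ⟨i, x⟩ ⟨j, y⟩ k
    obtain rfl := hr i j ⟨(Groupoid.isoEquivHom (r i) (r j)).symm k⟩
    obtain ⟨a, ha⟩ := (hφ i).surjective k
    exact ⟨Sigma.SigmaHom.mk (C := fun i => SingleObj (A i)) (X := x) (Y := y) a, ha⟩⟩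
  essSurj := ⟨fun x => by
    obtain ⟨i, hi⟩ := hsurj x
    exact ⟨⟨i, SingleObj.star _⟩, hi⟩⟩

theorem componentsFunctor_out_isEquivalence (e : I ≃ Quotient (isIsomorphicSetoid G))
    (φ : ∀ i, A i →* End (e i).out) (hφ : ∀ i, Function.Bijective (φ i)) :
    (componentsFunctor (fun i => (e i).out) φ).IsEquivalence := by
  refine componentsFunctor_isEquivalence _ φ
    (fun i j hij => e.injective (Quotient.out_equiv_out.1 hij)) (fun x => ⟨e.symm ⟦x⟧, ?_⟩) hφ
  rw [e.apply_symm_apply]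
  exact Quotient.mk_out (s := isIsomorphicSetoid G) x

end Components

theorem RelFin.nonempty_equivalence_of_component_iso {B : Type u} [Groupoid.{v} B]
    {G G' : Type u₁} [Groupoid.{v₁} G] [Groupoid.{v₁} G'] [∀ x : G, Finite (End x)]
    [∀ x : G', Finite (End x)] {F : G ⥤ B} {F' : G' ⥤ B} (hF : IsRelativelyFinite F)
    (hF' : IsRelativelyFinite F')
    (e : Quotient (isIsomorphicSetoid G) ≃ Quotient (isIsomorphicSetoid G'))
    (he : ∀ c, Nonempty (FinGrpOver.component F c ≅ FinGrpOver.component F' (e c))) :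
    Nonempty (Bicategory.Equivalence (RelFin.of F hF) (RelFin.of F' hF')) := by
  have k c := (he c).some
  let K := componentsFunctor (fun c : Quotient (isIsomorphicSetoid G) => c.out)
    fun c => MonoidHom.id (End c.out)
  let L := componentsFunctor (A := fun c : Quotient (isIsomorphicSetoid G) => End c.out)
    (fun c => (e c).out) fun c => (k c).hom.groupHom
  have hK : K.IsEquivalence :=
    componentsFunctor_out_isEquivalence (Equiv.refl _) _ fun _ => Function.bijective_id
  have hL : L.IsEquivalence :=
    componentsFunctor_out_isEquivalence e _ fun c => FinGrpOver.bijective_groupHom (k c).hom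
  let θ : K ⋙ F ≅ L ⋙ F' := Sigma.natIso fun c => NatIso.ofComponents
    (fun _ => (Groupoid.isoEquivHom _ _).symm (k c).hom.objHom) fun h => (k c).hom.comm h
  exact nonempty_equivalence_of_span hF hF' K L θ

theorem mainTheorem1 {B : Type u} [Groupoid.{v} B] (hB : IsLocallyFiniteGroupoid B)
    {G G' : Type u₁} [Groupoid.{v₁} G] [Groupoid.{v₁} G'] (F : G ⥤ B) (F' : G' ⥤ B)
    (hF : IsRelativelyFinite F) (hF' : IsRelativelyFinite F')
    (hcard : ∀ (H : Type v₁) [Group H] [Finite H] (S : SingleObj H ⥤ B),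
      groupoidCardinality (RelFin.ofGroup S ⟶ RelFin.of F hF) =
        groupoidCardinality (RelFin.ofGroup S ⟶ RelFin.of F' hF')) :
    Nonempty (Bicategory.Equivalence (RelFin.of F hF) (RelFin.of F' hF')) := by
  have := hF.finite_end
  have := hF'.finite_end
  have hmass (S : FinGrpOver.{v, u, v₁} B) : FinGrpOver.homMass (FinGrpOver.component F) S =
      FinGrpOver.homMass (FinGrpOver.component F') S := by
    rw [← FinGrpOver.groupoidCardinality_hom_ofGroup F hF,
      ← FinGrpOver.groupoidCardinality_hom_ofGroup F' hF']
    exact hcard S.group (SingleObj.functor S.action)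
  obtain ⟨e, he⟩ := FinGrpOver.exists_equiv_of_homMass_eq hB
    hF.isRelativelyFiniteFamily_component hF'.isRelativelyFiniteFamily_component hmass
  exact RelFin.nonempty_equivalence_of_component_iso hF hF' e he
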